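/- Let $\mathbb F_2$ be the field with two elements. A Boolean function in $m$ variables is a map $f:\mathbb F_2^m\to\mathbb F_2$. For a linear subspace $V\subseteq\mathbb F_2^m$ and $a\in\mathbb F_2^m$, let $f_{a,V}:V\to\mathbb F_2$, $v\mapsto f(a+v)$, be the restriction of $f$ to the flat $a+V$. The function $f$ is called normal if $f_{a,V}$ is constant for some $a$ and some $V$ with $\dim V=\lceil m/2\rceil$, and weakly normal if $f_{a,V}$ is affine (that is, of the form $v\mapsto \ell(v)+c$ with $\ell:V\to\mathbb F_2$ linear and $c\in\mathbb F_2$) and not constant for some $a$ and some $V$ with $\dim V=\lceil m/2\rceil$. Theorem. Every Boolean function in $5$ variables is normal or weakly normal; that is, its restriction to some $3$-dimensional affine subspace of $\mathbb F_2^5$ is constant or affine. Every Boolean function in $6$ variables is normal; that is, it is constant on some $3$-dimensional affine subspace of $\mathbb F_2^6$. -/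

import Mathlib

/-- The set `B(m)` of Boolean functions in `m` variables, i.e. maps `𝔽₂^m → 𝔽₂`. -/
abbrev BooleanFunction (m : ℕ) : Type := (Fin m → ZMod 2) → ZMod 2

namespace BooleanFunction

variable {m : ℕ}

/-- The restriction of `f` to the flat `a + V`, as the function `v ↦ f (a + v)` on the direction
space `V`. -/
def restrictFlat (f : BooleanFunction m) (a : Fin m → ZMod 2)
    (V : Submodule (ZMod 2) (Fin m → ZMod 2)) : V → ZMod 2 :=
  fun v => f (a + v)

/-- `f` is constant on the flat `a + V`. -/
def IsConstantOnFlat (f : BooleanFunction m) (a : Fin m → ZMod 2)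
    (V : Submodule (ZMod 2) (Fin m → ZMod 2)) : Prop :=
  ∃ c : ZMod 2, ∀ v : V, f.restrictFlat a V v = c

/-- `f` is affine (possibly constant) on the flat `a + V`: its restriction has the form
`v ↦ ℓ v + c` with `ℓ` linear, i.e. it is an affine map `V → 𝔽₂`. -/
def IsAffineOnFlat (f : BooleanFunction m) (a : Fin m → ZMod 2)
    (V : Submodule (ZMod 2) (Fin m → ZMod 2)) : Prop :=
  ∃ (l : V →ₗ[ZMod 2] ZMod 2) (c : ZMod 2), ∀ v : V, f.restrictFlat a V v = l v + c

/-- `f` is normal if it is constant on some flat of dimension `⌈m / 2⌉`. The natural number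
`(m + 1) / 2` is `⌈m / 2⌉`. -/
def IsNormal (f : BooleanFunction m) : Prop :=
  ∃ (a : Fin m → ZMod 2) (V : Submodule (ZMod 2) (Fin m → ZMod 2)),
    Module.finrank (ZMod 2) V = (m + 1) / 2 ∧ f.IsConstantOnFlat a V

/-- `f` is weakly normal if it is affine and not constant on some flat of dimension `⌈m / 2⌉`. -/
def IsWeaklyNormal (f : BooleanFunction m) : Prop :=
  ∃ (a : Fin m → ZMod 2) (V : Submodule (ZMod 2) (Fin m → ZMod 2)),
    Module.finrank (ZMod 2) V = (m + 1) / 2 ∧ f.IsAffineOnFlat a V ∧ ¬ f.IsConstantOnFlat a V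

end BooleanFunction

/-!
The theorem rests on one fact about the group `𝔽₂^5`: among any eight of its points there are four
with sum zero (`exists_four_sum_eq_zero`). In coding terms, there is no binary linear
`[8, 2]` code of minimum distance `6`. Four distinct points with sum zero form a `2`-flat, so if `T`
consists of four such points in the hyperplane `xᵢ = 0` and `vᵢ = 1`, then `T ∪ (T + v)` is a
`3`-flat (`exists_flat_of_four`).

*Five variables.* Take `v = e₀`. The hyperplane `x₀ = 0` has sixteen points, so the derivative
`x ↦ f (x + v) + f x` takes the same value on at least eight of them. Replace the vanishing
coordinate `x₀` of these points by `f x` and apply the fact above: this gives four of them, with sum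
zero, whose values under `f` also have sum zero. Hence `f` is affine on the `2`-flat they form, and,
as the derivative in direction `v` is constant there, on the `3`-flat generated by it and `v`.

*Six variables.* At least half of the pairs `(x, y)` satisfy `f x = f y`, so averaging over the
nonzero differences yields some `v ≠ 0` with `f (x + v) = f x` for at least `32` points `x`
(`exists_direction`). Modulo `v` these are at least sixteen points, and `f` is constant on at least
eight of them; four of these have sum zero and generate, together with `v`, a `3`-flat on which `f`
is constant.
-/

namespace BooleanFunction

/-! ### Four points with sum zero -/

lemma sum_symmDiff_eq_add {α U : Type*} [DecidableEq α] [AddCommGroup U] [Module (ZMod 2) U]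
    (A B : Finset α) (g : α → U) :
    ∑ x ∈ symmDiff A B, g x = ∑ x ∈ A, g x + ∑ x ∈ B, g x := by
  have h : symmDiff A B = (A \ B) ∪ (B \ A) := rfl
  have hd : Disjoint (A \ B) (B \ A) := disjoint_sdiff_sdiff
  rw [h, Finset.sum_union hd, ← Finset.sum_inter_add_sum_sdiff A B g,
    ← Finset.sum_inter_add_sum_sdiff B A g, Finset.inter_comm B A]
  have := ZModModule.add_self (∑ x ∈ A ∩ B, g x)
  rw [add_add_add_comm, this, zero_add]

/-- A point lies in at most two of the three symmetric differences. -/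
lemma card_symmDiff_add_le {α : Type*} [DecidableEq α] {s A B C : Finset α}
    (hA : A ⊆ s) (hB : B ⊆ s) (hC : C ⊆ s) :
    (symmDiff A B).card + (symmDiff B C).card + (symmDiff A C).card ≤ 2 * s.card := by
  have key : ∀ D ⊆ s, D.card = ∑ x ∈ s, if x ∈ D then 1 else 0 := by
    intro D hD
    rw [← Finset.sum_filter, Finset.filter_mem_eq_inter, Finset.inter_eq_right.2 hD,
      Finset.card_eq_sum_ones]
  have hsub : ∀ {D E : Finset α}, D ⊆ s → E ⊆ s → symmDiff D E ⊆ s := fun hD hE =>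
    symmDiff_le_sup.trans (Finset.union_subset hD hE)
  rw [key _ (hsub hA hB), key _ (hsub hB hC), key _ (hsub hA hC), ← Finset.sum_add_distrib,
    ← Finset.sum_add_distrib, mul_comm, ← smul_eq_mul, ← Finset.sum_const]
  refine Finset.sum_le_sum fun x _ => ?_
  simp only [Finset.mem_symmDiff]
  by_cases a : x ∈ A <;> by_cases b : x ∈ B <;> by_cases c : x ∈ C <;> simp [a, b, c]

/-- Eight points of an elementary abelian group of order `32` contain four with sum zero. The points
are given as the values of an injective function `g` on a set `s`. -/
lemma exists_four_sum_eq_zero {α U : Type*} [AddCommGroup U] [Module (ZMod 2) U]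
    [Fintype U] (hU : Fintype.card U = 32) {s : Finset α} (hs : 8 ≤ s.card) {g : α → U}
    (hg : Set.InjOn g s) : ∃ T ⊆ s, T.card = 4 ∧ ∑ x ∈ T, g x = 0 := by
  classical
  obtain ⟨s', hs', hcard⟩ := Finset.exists_subset_card_eq hs
  -- The `256` subsets are classified by their sum and the parity of their size: `64` classes, so
  -- some class has at least three members.
  obtain ⟨y, -, hy⟩ := Finset.exists_lt_card_fiber_of_mul_lt_card_of_maps_to
    (s := s'.powerset) (t := (Finset.univ : Finset (U × ZMod 2)))
    (f := fun A => (∑ x ∈ A, g x, ∑ x ∈ A, (1 : ZMod 2))) (n := 2)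
    (fun _ _ => Finset.mem_univ _) (by
      rw [Finset.card_univ, Fintype.card_prod, hU, ZMod.card, Finset.card_powerset, hcard]
      norm_num)
  obtain ⟨A, B, C, hA, hB, hC, hAB, hAC, hBC⟩ := Finset.two_lt_card_iff.1 hy
  simp only [Finset.mem_filter, Finset.mem_powerset] at hA hB hC
  have pair : ∀ {D E : Finset α},
      (D ⊆ s' ∧ (∑ x ∈ D, g x, ∑ x ∈ D, (1 : ZMod 2)) = y) →
      (E ⊆ s' ∧ (∑ x ∈ E, g x, ∑ x ∈ E, (1 : ZMod 2)) = y) → D ≠ E →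
      (symmDiff D E).card ≤ 5 → ∃ T ⊆ s, T.card = 4 ∧ ∑ x ∈ T, g x = 0 := by
    intro D E hD hE hne hle
    have hsub : symmDiff D E ⊆ s :=
      (symmDiff_le_sup.trans (Finset.union_subset hD.1 hE.1)).trans hs'
    obtain ⟨hg', hone⟩ := Prod.mk.inj (hD.2.trans hE.2.symm)
    have hsum : ∑ x ∈ symmDiff D E, g x = 0 := by
      rw [sum_symmDiff_eq_add, hg', ZModModule.add_self]
    have hpar : ∑ x ∈ symmDiff D E, (1 : ZMod 2) = 0 := by
      rw [sum_symmDiff_eq_add, hone, ZModModule.add_self]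
    have heven : 2 ∣ (symmDiff D E).card := by
      rw [← ZMod.natCast_eq_zero_iff]
      simpa using hpar
    have h0 : (symmDiff D E).card ≠ 0 := by
      rw [Ne, Finset.card_eq_zero, ← Finset.bot_eq_empty, symmDiff_eq_bot]
      exact hne
    have h2 : (symmDiff D E).card ≠ 2 := by
      intro h2
      obtain ⟨p, q, hpq, hT⟩ := Finset.card_eq_two.1 h2
      rw [hT] at hsum hsub
      rw [Finset.sum_pair hpq, ← ZModModule.sub_eq_add, sub_eq_zero] at hsum
      exact hpq (hg (hsub (by simp)) (hsub (by simp)) hsum)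
    exact ⟨_, hsub, by omega, hsum⟩
  have hle := card_symmDiff_add_le hA.1 hB.1 hC.1
  by_cases h1 : (symmDiff A B).card ≤ 5
  · exact pair hA hB hAB h1
  by_cases h2 : (symmDiff B C).card ≤ 5
  · exact pair hB hC hBC h2
  exact pair hA hC hAC (by omega)

/-! ### Flats of dimension three -/

variable {m : ℕ}

lemma linearIndependent_of_distinct {a b c v : Fin m → ZMod 2} {i : Fin m} (hv : v i = 1)
    (ha : a i = 0) (hb : b i = 0) (hc : c i = 0) (hab : a ≠ b) (hac : a ≠ c) (hbc : b ≠ c) :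
    LinearIndependent (ZMod 2) ![v, a + b, a + c] := by
  rw [Fintype.linearIndependent_iff]
  intro ε hε
  simp only [Fin.sum_univ_three, Matrix.cons_val_zero, Matrix.cons_val_one,
    Matrix.cons_val] at hε
  have h0 : ε 0 = 0 := by simpa [hv, ha, hb, hc] using congrFun hε i
  rw [h0, zero_smul, zero_add] at hε
  have hbit : ∀ t : ZMod 2, t = 0 ∨ t = 1 := by decide
  have key : ∀ {x y : Fin m → ZMod 2}, x + y = 0 → x = y := fun h => by
    rwa [← ZModModule.sub_eq_add, sub_eq_zero] at h
  have h12 : ε 1 = 0 ∧ ε 2 = 0 := by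
    rcases hbit (ε 1) with h1 | h1 <;> rcases hbit (ε 2) with h2 | h2 <;>
      rw [h1, h2] at hε <;> simp only [zero_smul, one_smul, zero_add, add_zero] at hε
    · exact ⟨h1, h2⟩
    · exact absurd (key hε) hac
    · exact absurd (key hε) hab
    · rw [add_add_add_comm, ZModModule.add_self, zero_add] at hε
      exact absurd (key hε) hbc
  intro j
  fin_cases j
  exacts [h0, h12.1, h12.2]

/-- Four points `T` with sum zero in the hyperplane `xᵢ = 0` and a vector `v` outside its direction
span the `3`-flat `T ∪ (T + v)`. A function whose derivative in direction `v` is constant on `T` and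
whose values on `T` have sum zero is affine on this flat. -/
lemma exists_flat_of_four (f : BooleanFunction m) {T : Finset (Fin m → ZMod 2)}
    {v : Fin m → ZMod 2} {i : Fin m} (hv : v i = 1) (hT : ∀ x ∈ T, x i = 0) (hcard : T.card = 4)
    (hsum : ∑ x ∈ T, x = 0) {k : ZMod 2} (hk : ∀ x ∈ T, f (x + v) = f x + k)
    (hf : ∑ x ∈ T, f x = 0) :
    ∃ (a : Fin m → ZMod 2) (V : Submodule (ZMod 2) (Fin m → ZMod 2)),
      Module.finrank (ZMod 2) V = 3 ∧ (∀ u ∈ V, a + u ∈ T ∨ a + u + v ∈ T) ∧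
        f.IsAffineOnFlat a V := by
  obtain ⟨a, b, c, d, hab, hac, had, hbc, hbd, hcd, rfl⟩ := Finset.card_eq_four.1 hcard
  have ha := hT a (by simp)
  have hb := hT b (by simp)
  have hc := hT c (by simp)
  have hli := linearIndependent_of_distinct hv ha hb hc hab hac hbc
  have hsum4 : ∀ {M : Type} [AddCommGroup M] [Module (ZMod 2) M] (g : (Fin m → ZMod 2) → M),
      ∑ x ∈ {a, b, c, d}, g x = 0 → g d = g a + g b + g c := by
    intro M _ _ g h
    rw [Finset.sum_insert (by simp [hab, hac, had]), Finset.sum_insert (by simp [hbc, hbd]),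
      Finset.sum_pair hcd, ← add_assoc, ← add_assoc, ← ZModModule.sub_eq_add _ (g d),
      sub_eq_zero] at h
    exact h.symm
  have hd : d = a + b + c := hsum4 (fun x => x) hsum
  have hfd : f d = f a + f b + f c := hsum4 f hf
  have hbit : ∀ t : ZMod 2, t = 0 ∨ t = 1 := by decide
  -- Every point of the flat is `x + ε 0 • v` with `x` one of the four points, selected by `ε 1` and
  -- `ε 2`; the value of `f` at `x` is affine in `ε 1` and `ε 2`.
  have hpoint : ∀ ε : Fin 3 → ZMod 2, ∃ x ∈ ({a, b, c, d} : Finset (Fin m → ZMod 2)),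
      a + (ε 1 • (a + b) + ε 2 • (a + c)) = x ∧
        f x = ε 1 * (f a + f b) + ε 2 * (f a + f c) + f a := by
    intro ε
    have e2 : ∀ {M : Type} [AddCommGroup M] [Module (ZMod 2) M] (p q : M), p + (p + q) = q :=
      fun p q => by rw [← add_assoc, ZModModule.add_self, zero_add]
    rcases hbit (ε 1) with h1 | h1 <;> rcases hbit (ε 2) with h2 | h2 <;>
      simp only [h1, h2, zero_smul, one_smul, zero_add, add_zero, zero_mul, one_mul]
    · exact ⟨a, by simp, rfl, rfl⟩
    · exact ⟨c, by simp, e2 a c, by rw [add_comm, e2]⟩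
    · exact ⟨b, by simp, e2 a b, by rw [add_comm, e2]⟩
    · refine ⟨d, by simp, ?_, ?_⟩
      · rw [hd, add_assoc, e2, add_left_comm, add_assoc]
      · rw [hfd, add_assoc (f a + f b), add_comm (f a + f c), e2]
  let β := Module.Basis.span hli
  have hrepr : ∀ u : Submodule.span (ZMod 2) (Set.range ![v, a + b, a + c]),
      (u : Fin m → ZMod 2) =
        β.repr u 0 • v + (β.repr u 1 • (a + b) + β.repr u 2 • (a + c)) := by
    intro u
    conv_lhs => rw [← β.sum_repr u]
    simp [Fin.sum_univ_three, β, Module.Basis.span_apply, add_assoc]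
  refine ⟨a, Submodule.span (ZMod 2) (Set.range ![v, a + b, a + c]), ?_, ?_, ?_⟩
  · simpa using finrank_span_eq_card hli
  · intro u hu
    obtain ⟨x, hx, hxe, -⟩ := hpoint (β.repr ⟨u, hu⟩)
    have hu' := hrepr ⟨u, hu⟩
    simp only at hu'
    rcases hbit (β.repr ⟨u, hu⟩ 0) with h0 | h0
    · left
      rw [hu', h0, zero_smul, zero_add, hxe]
      exact hx
    · right
      rw [hu', h0, one_smul, add_left_comm, hxe, add_comm v x, add_assoc, ZModModule.add_self,
        add_zero]
      exact hx
  · refine ⟨β.constr (ZMod 2) ![k, f a + f b, f a + f c], f a, fun u => ?_⟩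
    obtain ⟨x, hx, hxe, hfx⟩ := hpoint (β.repr u)
    have hl : β.constr (ZMod 2) ![k, f a + f b, f a + f c] u =
        β.repr u 0 * k + (β.repr u 1 * (f a + f b) + β.repr u 2 * (f a + f c)) := by
      rw [Module.Basis.constr_apply_fintype]
      simp [Fin.sum_univ_three, add_assoc]
    rw [hl, restrictFlat, hrepr u, add_left_comm, hxe, add_assoc, ← hfx]
    rcases hbit (β.repr u 0) with h0 | h0
    · simp [h0]
    · rw [h0, one_smul, add_comm v x, hk x hx, one_mul, add_comm]

/-! ### Five variables -/

lemma card_hyperplane {n : ℕ} (i : Fin (n + 1)) :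
    (Finset.univ.filter fun x : Fin (n + 1) → ZMod 2 => x i = 0).card = 2 ^ n := by
  have e : (Finset.univ.filter fun x : Fin (n + 1) → ZMod 2 => x i = 0) =
      Finset.univ.image (i.insertNth (α := fun _ => ZMod 2) 0) := by
    ext x
    simp only [Finset.mem_filter, Finset.mem_univ, true_and, Finset.mem_image]
    constructor
    · intro h
      exact ⟨i.removeNth x, by rw [← h, Fin.insertNth_self_removeNth]⟩
    · rintro ⟨y, rfl⟩
      simp
  rw [e, Finset.card_image_of_injective _ (Fin.insertNth_right_injective (α := fun _ => ZMod 2) 0)]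
  simp [ZMod.card]

lemma exists_affine_flat_five (f : BooleanFunction 5) :
    ∃ (a : Fin 5 → ZMod 2) (V : Submodule (ZMod 2) (Fin 5 → ZMod 2)),
      Module.finrank (ZMod 2) V = 3 ∧ f.IsAffineOnFlat a V := by
  let v : Fin 5 → ZMod 2 := Pi.single 0 1
  obtain ⟨k, -, hk⟩ := Finset.exists_le_card_fiber_of_mul_le_card_of_maps_to
    (s := Finset.univ.filter fun x : Fin 5 → ZMod 2 => x 0 = 0)
    (t := (Finset.univ : Finset (ZMod 2))) (f := fun x => f (x + v) - f x) (n := 8)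
    (fun _ _ => Finset.mem_univ _) Finset.univ_nonempty
    (by rw [card_hyperplane, Finset.card_univ, ZMod.card]; norm_num)
  rw [Finset.filter_filter] at hk
  obtain ⟨T, hTs, hT, hsum⟩ := exists_four_sum_eq_zero (U := Fin 5 → ZMod 2)
    (by simp [ZMod.card]) hk (g := fun x => Function.update x 0 (f x)) (by
      intro x hx y hy hxy
      simp only [Finset.coe_filter, Finset.mem_univ, true_and, Set.mem_ofPred_eq] at hx hy
      funext j
      by_cases hj : j = 0
      · rw [hj, hx.1, hy.1]
      · simpa [hj] using congrFun hxy j)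
  have hmem : ∀ x ∈ T, x 0 = 0 ∧ f (x + v) - f x = k := fun x hx => by
    simpa using hTs hx
  have hf : ∑ x ∈ T, f x = 0 := by
    simpa [Finset.sum_apply] using congrFun hsum 0
  have hT0 : ∑ x ∈ T, x = 0 := by
    funext j
    by_cases hj : j = 0
    · rw [Finset.sum_apply, hj]
      exact Finset.sum_eq_zero fun x hx => (hmem x hx).1
    · simpa [Finset.sum_apply, hj] using congrFun hsum j
  obtain ⟨a, V, hV, -, h⟩ := exists_flat_of_four f (v := v) (i := 0) (by simp [v])
    (fun x hx => (hmem x hx).1) hT hT0 (fun x hx => sub_eq_iff_eq_add'.1 (hmem x hx).2) hf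
  exact ⟨a, V, hV, h⟩

/-! ### Six variables -/

/-- Some nonzero direction `v` has `f (x + v) = f x` for at least half of the points `x`: at least
`32² + 32²` of the pairs `(x, y)` satisfy `f x = f y`, only `64` of them with `x = y`, and
`32² + 32² - 64 > 63 * 31`. -/
lemma exists_direction (f : BooleanFunction 6) :
    ∃ v : Fin 6 → ZMod 2, v ≠ 0 ∧ 32 ≤ (Finset.univ.filter fun x => f (x + v) = f x).card := by
  by_contra! hcon
  let n : ZMod 2 → ℕ := fun k => (Finset.univ.filter fun x => f x = k).card
  have hn : n 0 + n 1 = 64 := by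
    have h := Finset.card_eq_sum_card_fiberwise (s := Finset.univ)
      (t := (Finset.univ : Finset (ZMod 2))) (f := f)
      (fun _ _ => Finset.mem_coe.2 (Finset.mem_univ _))
    have h2 : ∑ k : ZMod 2, n k = n 0 + n 1 := Fin.sum_univ_two n
    rw [← h2]
    simpa [ZMod.card] using h.symm
  have hinner : ∀ x, ∑ v, (if f (x + v) = f x then 1 else 0) = n (f x) := by
    intro x
    refine (Equiv.sum_comp (Equiv.addLeft x) fun y => if f y = f x then 1 else 0).trans ?_
    simp [n]
  have hpairs : ∑ v, (Finset.univ.filter fun x => f (x + v) = f x).card = n 0 ^ 2 + n 1 ^ 2 := by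
    simp only [Finset.card_filter]
    rw [Finset.sum_comm]
    simp only [hinner]
    rw [← Finset.sum_fiberwise (s := Finset.univ) (g := f)]
    have h2 : ∀ k : ZMod 2, ∑ x with f x = k, n (f x) = n k ^ 2 := by
      intro k
      rw [Finset.sum_congr rfl (g := fun _ => n k) (fun x hx => by rw [(Finset.mem_filter.1 hx).2]),
        Finset.sum_const, smul_eq_mul, sq]
    simp only [h2]
    exact Fin.sum_univ_two fun k : ZMod 2 => n k ^ 2
  rw [← Finset.add_sum_erase _ _ (Finset.mem_univ 0)] at hpairs
  have hbound := Finset.sum_le_card_nsmul (Finset.univ.erase (0 : Fin 6 → ZMod 2))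
    (fun v => (Finset.univ.filter fun x => f (x + v) = f x).card) 31
    (fun v hv => Nat.le_of_lt_succ (hcon v (Finset.ne_of_mem_erase hv)))
  rw [Finset.card_erase_of_mem (Finset.mem_univ _)] at hbound
  simp [ZMod.card] at hbound hpairs
  have : n 1 = 64 - n 0 := by omega
  zify at hn hbound hpairs
  nlinarith [sq_nonneg ((n 0 : ℤ) - n 1)]

/-- A set invariant under translation by `v` has at least half of its points in any hyperplane
`xᵢ = 0` with `vᵢ = 1`. -/
lemma card_le_two_mul_card_hyperplane {v : Fin m → ZMod 2} {i : Fin m} (hv : v i = 1)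
    {s : Finset (Fin m → ZMod 2)} (hs : ∀ x ∈ s, x + v ∈ s) :
    s.card ≤ 2 * (s.filter fun x => x i = 0).card := by
  rw [← Finset.card_filter_add_card_filter_not (s := s) (fun x => x i = 0), two_mul]
  refine Nat.add_le_add_left (Finset.card_le_card_of_injOn (· + v) ?_
    (add_left_injective v).injOn) _
  intro x hx
  have hbit : ∀ t : ZMod 2, t ≠ 0 → t + 1 = 0 := by decide
  simp only [Finset.coe_filter, Set.mem_ofPred_eq] at hx ⊢
  exact ⟨hs x hx.1, by rw [Pi.add_apply, hv, hbit _ hx.2]⟩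

lemma exists_constant_flat_six (f : BooleanFunction 6) :
    ∃ (a : Fin 6 → ZMod 2) (V : Submodule (ZMod 2) (Fin 6 → ZMod 2)),
      Module.finrank (ZMod 2) V = 3 ∧ f.IsConstantOnFlat a V := by
  obtain ⟨v, hv0, hv⟩ := exists_direction f
  obtain ⟨i, hi⟩ := Function.ne_iff.1 hv0
  have hi : v i = 1 := (by decide : ∀ t : ZMod 2, t ≠ 0 → t = 1) _ hi
  have hhalf := card_le_two_mul_card_hyperplane hi
    (s := Finset.univ.filter fun x => f (x + v) = f x) (fun x hx => by
      simp only [Finset.mem_filter, Finset.mem_univ, true_and] at hx ⊢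
      rw [add_assoc, ZModModule.add_self, add_zero, hx])
  obtain ⟨k, -, hk⟩ := Finset.exists_le_card_fiber_of_mul_le_card_of_maps_to
    (s := (Finset.univ.filter fun x => f (x + v) = f x).filter fun x => x i = 0)
    (t := (Finset.univ : Finset (ZMod 2))) (f := f) (n := 8)
    (fun _ _ => Finset.mem_univ _) Finset.univ_nonempty
    (by rw [Finset.card_univ, ZMod.card]; omega)
  rw [Finset.filter_filter, Finset.filter_filter] at hk
  obtain ⟨T, hTs, hT, hsum⟩ := exists_four_sum_eq_zero (U := Fin 5 → ZMod 2)
    (by simp [ZMod.card]) hk (g := fun x => i.removeNth x) (by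
      intro x hx y hy hxy
      simp only [Finset.coe_filter, Finset.mem_univ, true_and, Set.mem_ofPred_eq] at hx hy
      rw [← Fin.insertNth_self_removeNth i x, ← Fin.insertNth_self_removeNth i y, hx.2.1, hy.2.1]
      exact congrArg _ hxy)
  have hmem : ∀ x ∈ T, f (x + v) = f x ∧ x i = 0 ∧ f x = k := fun x hx => by
    simpa using hTs hx
  have hT0 : ∑ x ∈ T, x = 0 := by
    funext j
    rw [Finset.sum_apply]
    rcases Fin.eq_self_or_eq_succAbove i j with rfl | ⟨l, rfl⟩
    · exact Finset.sum_eq_zero fun x hx => (hmem x hx).2.1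
    · simpa [Finset.sum_apply, Fin.removeNth] using congrFun hsum l
  have hf : ∑ x ∈ T, f x = 0 := by
    rw [Finset.sum_congr rfl fun x hx => (hmem x hx).2.2, Finset.sum_const, hT]
    exact (by decide : ∀ t : ZMod 2, 4 • t = 0) k
  obtain ⟨a, V, hV, hmemV, -⟩ := exists_flat_of_four f hi (fun x hx => (hmem x hx).2.1) hT hT0
    (k := 0) (fun x hx => by rw [(hmem x hx).1, add_zero]) hf
  refine ⟨a, V, hV, k, fun u => ?_⟩
  rcases hmemV u u.2 with h | h
  · exact (hmem _ h).2.2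
  · have h' := (hmem _ h).1
    rw [add_assoc, ZModModule.add_self, add_zero, (hmem _ h).2.2] at h'
    exact h'

end BooleanFunction

theorem mainTheorem3 :
    (∀ f : BooleanFunction 5, f.IsNormal ∨ f.IsWeaklyNormal) ∧
      (∀ f : BooleanFunction 6, f.IsNormal) := by
  refine ⟨fun f => ?_, fun f => f.exists_constant_flat_six⟩
  obtain ⟨a, V, hV, h⟩ := f.exists_affine_flat_five
  by_cases hc : f.IsConstantOnFlat a V
  · exact Or.inl ⟨a, V, hV, hc⟩
  · exact Or.inr ⟨a, V, hV, h, hc⟩
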